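/- **Setting.** Let $\Pi$ be a measurable space (decisions), $\mathcal R\subseteq\mathbb R$ (rewards) and $\mathcal O$ a measurable space (observations), such that $\Pi$ is countable or the $\sigma$-algebra of $\mathcal R\times\mathcal O$ is countably generated. Let $\mathcal M^+$ be the set of all models, i.e. probability kernels $M:\Pi\to\triangle_{\mathcal R\times\mathcal O}$ for which the mean reward $f^M(\pi)=\mathbb E_{(r,o)\sim M(\pi)}[r]$ exists and lies in $[0,1]$ for every $\pi$. For $M\in\mathcal M^+$ write $\boldsymbol\pi_M=\operatorname{argmax}_\pi f^M(\pi)$ for the set of optimal decisions, $\Delta^M(\pi)=\sup_{\pi'}f^M(\pi')-f^M(\pi)$, and $\Delta^M_{\min}=\inf\{\Delta^M(\pi):\Delta^M(\pi)>0\}$ if the optimal decision of $M$ is unique, $\Delta^M_{\min}=0$ otherwise. All quantities take values in $[0,\infty]$, with $\inf\emptyset=\infty$, $\sup\emptyset=0$, $x/0=\infty$ for $x>0$, $0/0=0$, $x/\infty=0$, $0\cdot\infty=0$. Let $\mathcal M\subseteq\mathcal M^+$ be a model class, $\mathcal M^{\mathrm{alt}}(M)=\{M'\in\mathcal M:\boldsymbol\pi_M\cap\boldsymbol\pi_{M'}=\emptyset\}$,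 and let the Graves-Lai coefficient be $$g^M=\inf_{\eta\in\mathbb R_+^\Pi}\Big\{\sum_{\pi}\eta(\pi)\Delta^M(\pi)\ :\ \sum_\pi\eta(\pi)D_{\mathsf{KL}}(M(\pi)\,\|\,M'(\pi))\ge1\ \ \forall M'\in\mathcal M^{\mathrm{alt}}(M)\Big\}.$$ For $n>0$ call a probability measure $\lambda\in\triangle_\Pi$ *$\varepsilon$-optimal for $M$ with normalization factor $n$* if $$\mathbb E_{\pi\sim\lambda}[\Delta^M(\pi)]\le\frac{(1+\varepsilon)g^M}{n}\quad\text{and}\quad\inf_{M'\in\mathcal M^{\mathrm{alt}}(M)}\mathbb E_{\pi\sim\lambda}[D_{\mathsf{KL}}(M(\pi)\,\|\,M'(\pi))]\ge\frac{1-\varepsilon}{n}.$$ Let $\Lambda(M;\varepsilon)$ be the set of those $\lambda$ for which this holds for some $n\in(0,\infty)$, $\Lambda(M;\varepsilon,n_{\max})$ the set of those for which it holds for some $n\in(0,n_{\max}]$, and $\mathcal M^{\mathrm{gl}}_\varepsilon(\lambda)=\{M\in\mathcal M:\lambda\in\Lambda(M;\varepsilon)\}$. For $\mathcal N\subseteq\mathcal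 M$ and $\overline M\in\mathcal M^+$ the Allocation-Estimation Coefficient is $$\mathrm{AEC}_\varepsilon(\mathcal N,\overline M)=\inf_{\lambda,\omega\in\triangle_\Pi}\ \sup_{M\in\mathcal N\setminus\mathcal M^{\mathrm{gl}}_\varepsilon(\lambda)}\frac1{\mathbb E_{\pi\sim\omega}[D_{\mathsf{KL}}(\overline M(\pi)\,\|\,M(\pi))]},$$ and for $\mathcal M_0\subseteq\mathcal M$ we set $$\mathcal M_0^{\mathrm{opt}}(\overline M)=\{M\in\mathcal M_0:\boldsymbol\pi_M\subseteq\boldsymbol\pi_{\overline M},\ D_{\mathsf{KL}}(\overline M(\pi)\,\|\,M(\pi))=0\ \ \forall\pi\in\boldsymbol\pi_{\overline M}\}.$$ An algorithm $\mathbb A=(p,q)$ with horizon $T$ consists of probability kernels $p^t(\cdot\mid\mathcal H^{t-1})$, $t=1,\dots,T$, on $\Pi$ and a probability kernel $q(\cdot\mid\mathcal H^T)$ on $\triangle_\Pi$: in round $t$ it draws $\pi^t\sim p^t(\cdot\mid\mathcal H^{t-1})$ and observes $(r^t,o^t)\sim M(\pi^t)$; here $\mathcal H^t=(\pi^1,r^1,o^1),\dots,(\pi^t,r^t,o^t)$,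 and at the end it returns $\widehat\lambda\sim q(\cdot\mid\mathcal H^T)$. Let $\mathbb P^{M,\mathbb A}$, $\mathbb E^{M,\mathbb A}$ denote the law and expectation when $M$ is the underlying model, and let $\mathbf{Reg}(T)=\sum_{t=1}^T\mathbb E_{\pi\sim p^t}[\Delta^M(\pi)]$. **Theorem.** There is an absolute constant $c>0$ such that the following holds for all $\Pi,\mathcal R,\mathcal O$ as above. Let $\mathcal M_0\subseteq\mathcal M\subseteq\mathcal M^+$, $\varepsilon>0$, $n_{\max}>0$, let $T\ge1$ be an integer, and put $$\delta=\frac\varepsilon2\cdot\min\Big\{1,\ \inf_{M\in\mathcal M_0}\frac{g^M}{n_{\max}}\Big\}.$$ If $$\sup_{M\in\mathcal M_0}\frac{g^M}{\Delta^M_{\min}}\cdot\log T\;<\;c\,\delta^2\cdot\sup_{\overline M\in\mathcal M^+}\mathrm{AEC}_{2\varepsilon}\big(\mathcal M_0^{\mathrm{opt}}(\overline M),\overline M\big),$$ then there is no algorithm $\mathbb A$ with horizon $T$ that simultaneously ensures 1. $\mathbb E^{M,\mathbb A}[\mathbf{Reg}(T)]\le2\,g^M\log T$ for all $M\in\mathcal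 M_0$, and 2. $\mathbb P^{M,\mathbb A}\big[\widehat\lambda\notin\Lambda(M;\varepsilon,n_{\max})\big]\le\delta/12$ for all $M\in\mathcal M_0$. -/

import Mathlib

open MeasureTheory ProbabilityTheory InformationTheory
open scoped ENNReal

noncomputable section

namespace DMSO

/-- A model `M : D → Δ(R × O)` with decision space `D`, reward space `R ⊆ ℝ` and observation
space `O`: a probability kernel whose mean rewards exist and lie in `[0, 1]`.  The type
`Model D R O` is the class of all possible models. -/
structure Model (D : Type*) [MeasurableSpace D] (R : Set ℝ) (O : Type*) [MeasurableSpace O] where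
  /-- the law of the reward and the observation, given the decision -/
  law : Kernel D (R × O)
  isMarkov : IsMarkovKernel law
  integrable_reward : ∀ d : D, Integrable (fun x : R × O => (x.1 : ℝ)) (law d)
  mean_mem : ∀ d : D, (∫ x, (x.1 : ℝ) ∂(law d)) ∈ Set.Icc (0 : ℝ) 1

variable {D : Type*} [MeasurableSpace D] {R : Set ℝ} {O : Type*} [MeasurableSpace O]

/-! ### Means, gaps, divergences -/

/-- The mean reward of decision `d` under `M`. -/
def meanReward (M : Model D R O) (d : D) : ℝ := ∫ x, (x.1 : ℝ) ∂(M.law d)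

/-- The set of all optimal decisions of `M`. -/
def optSet (M : Model D R O) : Set D := {d | ∀ d' : D, meanReward M d' ≤ meanReward M d}

/-- The suboptimality gap of the decision `d` under `M`: maximal mean reward minus mean reward
of `d`. -/
def gap (M : Model D R O) (d : D) : ℝ≥0∞ :=
  ENNReal.ofReal ((⨆ d' : D, meanReward M d') - meanReward M d)

open Classical in
/-- The minimum gap: the infimum of the positive gaps if the optimal decision is unique, and `0`
otherwise. -/
def minGap (M : Model D R O) : ℝ≥0∞ :=
  if ∃! d : D, d ∈ optSet M then ⨅ d : {d : D // 0 < gap M d}, gap M d.1 else 0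

/-- The Kullback-Leibler divergence between `M(d)` and `M'(d)`. -/
def kl (M M' : Model D R O) (d : D) : ℝ≥0∞ := klDiv (M.law d) (M'.law d)

/-! ### Graves-Lai program -/

/-- The models in the class that have no optimal decision in common with `M`. -/
def altSet (𝓜 : Set (Model D R O)) (M : Model D R O) : Set (Model D R O) :=
  {M' ∈ 𝓜 | Disjoint (optSet M) (optSet M')}

/-- The Graves-Lai coefficient of `M` with respect to the class `𝓜`; it is `∞` if the program
is infeasible. -/
def glc (𝓜 : Set (Model D R O)) (M : Model D R O) : ℝ≥0∞ :=
  ⨅ (η : D → NNReal) (_ : ∀ M' ∈ altSet 𝓜 M, 1 ≤ ∑' d, (η d : ℝ≥0∞) * kl M M' d),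
    ∑' d, (η d : ℝ≥0∞) * gap M d

/-- `lam` is a normalized allocation that is `ε`-optimal for the Graves-Lai program of `M`, with
normalization factor `n`. -/
def IsGLWith (𝓜 : Set (Model D R O)) (M : Model D R O) (ε n : ℝ)
    (lam : ProbabilityMeasure D) : Prop :=
  ∫⁻ d, gap M d ∂(lam : Measure D) ≤ ENNReal.ofReal (1 + ε) * glc 𝓜 M / ENNReal.ofReal n ∧
    ENNReal.ofReal ((1 - ε) / n) ≤ ⨅ M' ∈ altSet 𝓜 M, ∫⁻ d, kl M M' d ∂(lam : Measure D)

/-- The normalized allocations that are `ε`-optimal for the Graves-Lai program of `M`. -/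
def glAlloc (𝓜 : Set (Model D R O)) (M : Model D R O) (ε : ℝ) : Set (ProbabilityMeasure D) :=
  {lam | ∃ n : ℝ, 0 < n ∧ IsGLWith 𝓜 M ε n lam}

/-- The normalized allocations that are `ε`-optimal for the Graves-Lai program of `M`, with
normalization factor at most `nmax`. -/
def glAllocMax (𝓜 : Set (Model D R O)) (M : Model D R O) (ε nmax : ℝ) :
    Set (ProbabilityMeasure D) :=
  {lam | ∃ n : ℝ, 0 < n ∧ n ≤ nmax ∧ IsGLWith 𝓜 M ε n lam}

/-- The models in the class for which `lam` is an `ε`-optimal Graves-Lai allocation. -/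
def glModels (𝓜 : Set (Model D R O)) (ε : ℝ) (lam : ProbabilityMeasure D) :
    Set (Model D R O) :=
  {M ∈ 𝓜 | lam ∈ glAlloc 𝓜 M ε}

/-! ### Allocation-Estimation Coefficient -/

/-- The Allocation-Estimation Coefficient with tolerance `ε`, where the supremum is over `𝓜₀`, the
Graves-Lai program is taken in `𝓜` and the reference model is `Mbar`.  A supremum over the empty
set is `0`, and `1 / 0 = ∞`, `1 / ∞ = 0`. -/
def aec (𝓜 : Set (Model D R O)) (ε : ℝ) (𝓜₀ : Set (Model D R O)) (Mbar : Model D R O) : ℝ≥0∞ :=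
  ⨅ (lam : ProbabilityMeasure D) (ω : ProbabilityMeasure D),
    ⨆ M ∈ 𝓜₀ \ glModels 𝓜 ε lam, (∫⁻ d, kl Mbar M d ∂(ω : Measure D))⁻¹

/-- The models in `𝓜₀` all of whose optimal decisions are optimal for `Mbar`, and which cannot be
told apart from `Mbar` by playing an optimal decision of `Mbar`. -/
def optModels (𝓜₀ : Set (Model D R O)) (Mbar : Model D R O) : Set (Model D R O) :=
  {M ∈ 𝓜₀ | optSet M ⊆ optSet Mbar ∧ ∀ d ∈ optSet Mbar, kl Mbar M d = 0}

/-! ### Algorithms -/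

/-- Histories of `t` rounds: decisions, rewards and observations. -/
abbrev Hist (D : Type*) (R : Set ℝ) (O : Type*) (t : ℕ) : Type _ := Fin t → D × (R × O)

/-- An algorithm with horizon `T`: the distribution `explore t` of the decision in round `t + 1`
given the history of the first `t` rounds (only `t < T` is used), and the distribution of the
normalized allocation that is returned given the whole history. -/
structure Algorithm (D : Type*) [MeasurableSpace D] (R : Set ℝ) (O : Type*) [MeasurableSpace O]
    (T : ℕ) where
  explore : (t : ℕ) → Kernel (Hist D R O t) D
  isMarkov_explore : ∀ t, IsMarkovKernel (explore t)
  output : Kernel (Hist D R O T) (ProbabilityMeasure D)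
  isMarkov_output : IsMarkovKernel output

/-- The law of the history of the first `t` rounds, when the algorithm `A` interacts with the
model `M`. -/
def histLaw {T : ℕ} (M : Model D R O) (A : Algorithm D R O T) : (t : ℕ) → Measure (Hist D R O t)
  | 0 => Measure.dirac (fun i => i.elim0)
  | t + 1 =>
    ((histLaw M A t) ⊗ₘ (A.explore t ⊗ₖ Kernel.prodMkLeft (Hist D R O t) M.law)).map
      (fun x => (Fin.snoc x.1 x.2 : Hist D R O (t + 1)))

/-- The regret of the algorithm `A` on the history `h`, when `M` is the underlying model: the sum
over the rounds of the mean gap of the exploration distribution. -/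
def regret {T : ℕ} (M : Model D R O) (A : Algorithm D R O T) (h : Hist D R O T) : ℝ≥0∞ :=
  ∑ t : Fin T, ∫⁻ d, gap M d ∂(A.explore t (fun i : Fin t => h (Fin.castLE t.is_le' i)))

/-- The expected regret of `A` under `M` after `T` rounds. -/
def expectedRegret {T : ℕ} (M : Model D R O) (A : Algorithm D R O T) : ℝ≥0∞ :=
  ∫⁻ h, regret M A h ∂(histLaw M A T)

/-- The law of the allocation that `A` returns under `M`. -/
def outputLaw {T : ℕ} (M : Model D R O) (A : Algorithm D R O T) :
    Measure (ProbabilityMeasure D) :=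
  (histLaw M A T).bind A.output

/-- The number `(ε / 2) * min {1, inf_{M ∈ 𝓜₀} glc(𝓜, M) / nmax}`. -/
def delta (𝓜 𝓜₀ : Set (Model D R O)) (ε nmax : ℝ) : ℝ≥0∞ :=
  ENNReal.ofReal (ε / 2) * min 1 (⨅ M ∈ 𝓜₀, glc 𝓜 M / ENNReal.ofReal nmax)

end DMSO

end

/-!
The proof is a change of measure between a reference model `Mbar`, whose Allocation-Estimation
Coefficient exceeds a suitable number `X`, and one model `M ∈ optModels 𝓜₀ Mbar`.

Let `U` be the set of decisions that are suboptimal for `Mbar`. A decision outside `U` gives no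
information on which `M ∈ optModels 𝓜₀ Mbar` is the true model, and a decision in `U` is suboptimal
for every such `M`. Logarithmic regret therefore bounds the mean number of decisions in `U` under
`M` by `2 * (glc 𝓜 M / minGap M) * log T` (`lintegral_cumul_le_of_expectedRegret_le`). This bound
holds under `M`, but a bound under `Mbar` is needed. So the algorithm is stopped (`stopped`) when
the sum of its conditional probabilities of deciding in `U` would exceed the budget
`B = δ * X / 3`; from then on it plays an optimal decision of `Mbar`. By Markov's inequality this
changes little under `M`, and the budget now holds surely, under `Mbar` as well.

Run the stopped algorithm under `Mbar`. Let `ω` be its normalized expected allocation on `U`, and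
`lam` the mean of the allocation that it returns; neither depends on `M`. The definition of the
coefficient provides an `M` for which `lam` is not `2 * ε`-optimal although the mean divergence
under `ω` is below `1 / X`. By the chain rule, the divergence between the two laws of the
history is then at most `B / X = δ / 3` (`exists_klDiv_histLaw_le_mul`). Hence the returned
allocation, which is `ε`-optimal for `M` with high probability under `M`, is so with probability
at least `1 - δ` under `Mbar` (`outputLaw_stopped_le`). As optimality is a pair of bounds that are
linear in the allocation and in the reciprocal of the normalization factor, the mean `lam` is
`2 * ε`-optimal for `M` (`mem_glAlloc_of_eq_bind`): `δ` is the failure probability that the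
tolerance can absorb. This is a contradiction.
-/

open MeasureTheory ProbabilityTheory InformationTheory
open scoped ENNReal

/-! ### Kullback-Leibler divergence -/

section KullbackLeibler

variable {α β γ : Type*} [MeasurableSpace α] [MeasurableSpace β] [MeasurableSpace γ]

lemma klDiv_withDensity (ν : Measure α) [IsFiniteMeasure ν] {f : α → ℝ≥0∞} (hf : Measurable f)
    [IsFiniteMeasure (ν.withDensity f)] :
    klDiv (ν.withDensity f) ν = ∫⁻ x, ENNReal.ofReal (klFun (f x).toReal) ∂ν := by
  rw [klDiv_eq_lintegral_klFun_of_ac (withDensity_absolutelyContinuous ν f)]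
  refine lintegral_congr_ae ?_
  filter_upwards [Measure.rnDeriv_withDensity ν hf] with x hx
  rw [hx]

section Kernel

variable [MeasurableSpace.CountableOrCountablyGenerated α β]
  (κ η : Kernel α β)

lemma measurable_klFun_rnDeriv :
    Measurable fun q : α × β ↦ ENNReal.ofReal (klFun (Kernel.rnDeriv κ η q.1 q.2).toReal) :=
  (measurable_klFun.comp (Kernel.measurable_rnDeriv κ η).ennreal_toReal).ennreal_ofReal

variable [IsFiniteKernel κ] [IsFiniteKernel η]

lemma klDiv_kernel_apply_of_ac {a : α} (h : κ a ≪ η a) :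
    klDiv (κ a) (η a) =
      ∫⁻ x, ENNReal.ofReal (klFun (Kernel.rnDeriv κ η a x).toReal) ∂(η a) := by
  rw [klDiv_eq_lintegral_klFun_of_ac h]
  refine lintegral_congr_ae ?_
  filter_upwards [Kernel.rnDeriv_eq_rnDeriv_measure (κ := κ) (η := η) (a := a)] with x hx
  rw [hx]

lemma measurable_klDiv_kernel : Measurable fun a ↦ klDiv (κ a) (η a) := by
  classical
  have h : (fun a ↦ klDiv (κ a) (η a)) = fun a ↦ if κ a ≪ η a then
      ∫⁻ x, ENNReal.ofReal (klFun (Kernel.rnDeriv κ η a x).toReal) ∂(η a) else ∞ := by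
    funext a
    split_ifs with h
    · exact klDiv_kernel_apply_of_ac κ η h
    · exact klDiv_of_not_ac h
  rw [h]
  exact Measurable.ite (Kernel.measurableSet_absolutelyContinuous κ η)
    ((measurable_klFun_rnDeriv κ η).lintegral_kernel_prod_right') measurable_const

/-- The divergence between two joint laws that differ only in the last kernel is at most the mean
divergence of that kernel. The last kernel depends on `α` alone, so that countability of `α`, not
of `γ × α`, gives a jointly measurable density. -/
lemma klDiv_compProd_prodMkLeft_le (μ : Measure γ) [IsFiniteMeasure μ] (p : Kernel γ α)
    [IsFiniteKernel p] :
    klDiv (μ ⊗ₘ (p ⊗ₖ Kernel.prodMkLeft γ κ)) (μ ⊗ₘ (p ⊗ₖ Kernel.prodMkLeft γ η)) ≤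
      ∫⁻ c, ∫⁻ a, klDiv (κ a) (η a) ∂(p c) ∂μ := by
  by_cases htop : ∫⁻ c, ∫⁻ a, klDiv (κ a) (η a) ∂(p c) ∂μ = ∞
  · rw [htop]; exact le_top
  have hkl := measurable_klDiv_kernel κ η
  have hac : ∀ᵐ c ∂μ, ∀ᵐ a ∂(p c), κ a ≪ η a := by
    filter_upwards [ae_lt_top hkl.lintegral_kernel htop] with c hc
    filter_upwards [ae_lt_top hkl hc.ne] with a ha
    by_contra hn
    exact ha.ne (klDiv_of_not_ac hn)
  set f : γ × (α × β) → ℝ≥0∞ := fun q ↦ Kernel.rnDeriv κ η q.2.1 q.2.2 with hf_def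
  have hf : Measurable f := (Kernel.measurable_rnDeriv κ η).comp measurable_snd
  have hden : μ ⊗ₘ (p ⊗ₖ Kernel.prodMkLeft γ κ) =
      (μ ⊗ₘ (p ⊗ₖ Kernel.prodMkLeft γ η)).withDensity f := by
    refine Measure.ext_of_lintegral _ fun G hG ↦ ?_
    rw [lintegral_withDensity_eq_lintegral_mul _ hf hG, Measure.lintegral_compProd hG,
      Measure.lintegral_compProd (hf.mul hG)]
    refine lintegral_congr_ae ?_
    filter_upwards [hac] with c hc
    rw [Kernel.lintegral_compProd _ _ _ (show Measurable fun b ↦ G (c, b) by fun_prop),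
      Kernel.lintegral_compProd _ _ _ (show Measurable fun b ↦ (f * G) (c, b) by fun_prop)]
    refine lintegral_congr_ae ?_
    filter_upwards [hc] with a ha
    simp only [Kernel.prodMkLeft_apply, Pi.mul_apply, hf_def]
    have hGa : Measurable fun b ↦ G (c, a, b) := by fun_prop
    conv_lhs => rw [← Kernel.withDensity_rnDeriv_eq ha]
    rw [Kernel.withDensity_apply _ (Kernel.measurable_rnDeriv κ η),
      lintegral_withDensity_eq_lintegral_mul _ (Kernel.measurable_rnDeriv_right κ η a) hGa]
    rfl
  have : IsFiniteMeasure ((μ ⊗ₘ (p ⊗ₖ Kernel.prodMkLeft γ η)).withDensity f) := by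
    rw [← hden]; infer_instance
  have hfk : Measurable fun q ↦ ENNReal.ofReal (klFun (f q).toReal) :=
    (measurable_klFun.comp hf.ennreal_toReal).ennreal_ofReal
  rw [hden, klDiv_withDensity _ hf, Measure.lintegral_compProd hfk]
  refine lintegral_mono_ae ?_
  filter_upwards [hac] with c hc
  rw [Kernel.lintegral_compProd _ _ _ (show Measurable fun b ↦
    ENNReal.ofReal (klFun (f (c, b)).toReal) from hfk.comp measurable_prodMk_left)]
  refine lintegral_mono_ae ?_
  filter_upwards [hc] with a ha
  rw [klDiv_kernel_apply_of_ac κ η ha]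
  rfl

end Kernel

lemma half_le_klFun_add_one {x : ℝ} (hx : 0 ≤ x) : x / 2 ≤ klFun x + 1 := by
  rw [klFun_apply]
  rcases hx.eq_or_lt with rfl | hx
  · simp
  have h1 : Real.log (2 / x) ≤ 2 / x - 1 := Real.log_le_sub_one_of_pos (by positivity)
  rw [Real.log_div two_ne_zero hx.ne'] at h1
  have h2 : x * (Real.log 2 - Real.log x) ≤ x * (2 / x - 1) :=
    mul_le_mul_of_nonneg_left h1 hx.le
  have h3 : x * (2 / x - 1) = 2 - x := by field_simp
  nlinarith [Real.log_two_gt_d9]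

/-- A change of measure: a `[0, 1]`-valued function whose mean is small under `ν` has a small mean
under every `μ` with a small divergence from `ν`. This is the variational bound
`∫ g ∂μ ≤ klDiv μ ν + ∫ (exp g - 1) ∂ν` at `g = log 2 * f`, simplified. -/
lemma lintegral_div_two_le_klDiv_add (μ ν : Measure α) [IsFiniteMeasure μ] [IsFiniteMeasure ν]
    {f : α → ℝ≥0∞} (hf : Measurable f) (hf1 : ∀ x, f x ≤ 1) :
    (∫⁻ x, f x ∂μ) / 2 ≤ klDiv μ ν + ∫⁻ x, f x ∂ν := by
  by_cases hac : μ ≪ ν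
  swap
  · simp [klDiv_of_not_ac hac]
  have hr := Measure.measurable_rnDeriv μ ν
  rw [klDiv_eq_lintegral_klFun_of_ac hac, ← lintegral_add_right _ hf,
    ← lintegral_rnDeriv_mul hac hf.aemeasurable, div_eq_mul_inv,
    ← lintegral_mul_const _ (show Measurable fun x ↦ μ.rnDeriv ν x * f x from hr.mul hf)]
  refine lintegral_mono_ae ?_
  filter_upwards [Measure.rnDeriv_lt_top μ ν] with x hx
  set r := μ.rnDeriv ν x
  have h1 : r * 2⁻¹ ≤ ENNReal.ofReal (klFun r.toReal) + 1 := by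
    rw [← ENNReal.ofReal_one, ← ENNReal.ofReal_add (klFun_nonneg ENNReal.toReal_nonneg) zero_le_one]
    refine le_trans (le_of_eq ?_)
      (ENNReal.ofReal_le_ofReal (half_le_klFun_add_one ENNReal.toReal_nonneg))
    rw [ENNReal.ofReal_div_of_pos two_pos, ENNReal.ofReal_toReal hx.ne, ENNReal.ofReal_ofNat,
      div_eq_mul_inv]
  calc r * f x * 2⁻¹ = f x * (r * 2⁻¹) := by ring
    _ ≤ f x * (ENNReal.ofReal (klFun r.toReal) + 1) := by gcongr
    _ = f x * ENNReal.ofReal (klFun r.toReal) + f x := by rw [mul_add, mul_one]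
    _ ≤ 1 * ENNReal.ofReal (klFun r.toReal) + f x := by gcongr; exact hf1 x
    _ = _ := by rw [one_mul]

/-- Every finite measure is its total mass times a probability measure; the probability measure
`μ₀` serves when the total mass is `0`. -/
lemma exists_probabilityMeasure_lintegral_eq (μ₀ : ProbabilityMeasure α) (ν : Measure α)
    [IsFiniteMeasure ν] :
    ∃ ω : ProbabilityMeasure α, ∀ f : α → ℝ≥0∞,
      ∫⁻ x, f x ∂ν = ν Set.univ * ∫⁻ x, f x ∂(ω : Measure α) := by
  rcases eq_or_ne ν 0 with rfl | h0
  · exact ⟨μ₀, fun f ↦ by simp⟩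
  have : NeZero ν := ⟨h0⟩
  have hu : ν Set.univ ≠ 0 := by simpa using h0
  refine ⟨⟨(ν Set.univ)⁻¹ • ν, inferInstance⟩, fun f ↦ ?_⟩
  rw [ProbabilityMeasure.coe_mk, lintegral_smul_measure, smul_eq_mul, ← mul_assoc,
    ENNReal.mul_inv_cancel hu (measure_ne_top _ _), one_mul]

end KullbackLeibler

namespace DMSO

variable {D : Type*} [MeasurableSpace D] {R : Set ℝ} {O : Type*} [MeasurableSpace O]

attribute [instance] Model.isMarkov Algorithm.isMarkov_explore Algorithm.isMarkov_output

/-! ### The law of the history -/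

lemma measurable_snoc (t : ℕ) :
    Measurable fun x : Hist D R O t × (D × (R × O)) ↦ (Fin.snoc x.1 x.2 : Hist D R O (t + 1)) := by
  refine measurable_pi_iff.2 fun i ↦ ?_
  refine Fin.lastCases ?_ (fun j ↦ ?_) i
  · simpa using measurable_snd
  · simp only [Fin.snoc_castSucc]
    exact (measurable_pi_apply j).comp measurable_fst

instance isProbabilityMeasure_histLaw {T : ℕ} (M : Model D R O) (A : Algorithm D R O T) (t : ℕ) :
    IsProbabilityMeasure (histLaw M A t) := by
  induction t with
  | zero => rw [histLaw]; infer_instance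
  | succ t ih =>
    rw [histLaw]
    exact Measure.isProbabilityMeasure_map (measurable_snoc t).aemeasurable

lemma lintegral_histLaw_succ {T : ℕ} (M : Model D R O) (A : Algorithm D R O T) (t : ℕ)
    {G : Hist D R O (t + 1) → ℝ≥0∞} (hG : Measurable G) :
    ∫⁻ h, G h ∂(histLaw M A (t + 1)) =
      ∫⁻ h, ∫⁻ d, ∫⁻ x, G (Fin.snoc h (d, x)) ∂(M.law d) ∂(A.explore t h) ∂(histLaw M A t) := by
  have hGs : Measurable fun x : Hist D R O t × (D × (R × O)) ↦
    G (Fin.snoc x.1 x.2 : Hist D R O (t + 1)) := hG.comp (measurable_snoc t)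
  rw [histLaw, lintegral_map hG (measurable_snoc t), Measure.lintegral_compProd hGs]
  refine lintegral_congr fun h ↦ ?_
  rw [Kernel.lintegral_compProd _ _ _ (show Measurable fun b : D × (R × O) ↦
    G (Fin.snoc h b : Hist D R O (t + 1)) from hGs.comp measurable_prodMk_left)]
  rfl

/-- The chain rule, as an inequality: the divergence between the laws of the histories is at most
the sum over the rounds of the expected divergence between the models, where decisions and
expectation come from the first model. -/
lemma klDiv_histLaw_le [MeasurableSpace.CountableOrCountablyGenerated D (R × O)] {T : ℕ}
    (M M' : Model D R O) (A : Algorithm D R O T) (t : ℕ) :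
    klDiv (histLaw M A t) (histLaw M' A t) ≤
      ∑ s ∈ Finset.range t, ∫⁻ h, ∫⁻ d, kl M M' d ∂(A.explore s h) ∂(histLaw M A s) := by
  induction t with
  | zero => simp [histLaw]
  | succ t ih =>
    rw [Finset.sum_range_succ, histLaw, histLaw]
    refine (klDiv_map_le _ _ (measurable_snoc t)).trans ?_
    rw [klDiv_compProd_eq_add]
    exact add_le_add ih (klDiv_compProd_prodMkLeft_le M.law M'.law _ _)

/-! ### Sums along a history -/

/-- The sum along a history of length `t` of a quantity that depends, in each round, on the
history before that round. -/
noncomputable def cumul (F : (s : ℕ) → Hist D R O s → ℝ≥0∞) (t : ℕ) (h : Hist D R O t) : ℝ≥0∞ :=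
  ∑ s : Fin t, F s (fun i : Fin s ↦ h (Fin.castLE s.is_le' i))

variable {F : (s : ℕ) → Hist D R O s → ℝ≥0∞}

lemma measurable_cumul (hF : ∀ s, Measurable (F s)) (t : ℕ) : Measurable (cumul F t) := by
  refine Finset.measurable_sum _ fun s _ ↦ (hF s).comp ?_
  exact measurable_pi_iff.2 fun i ↦ measurable_pi_apply _

lemma cumul_snoc {D O : Type*} {R : Set ℝ} (F : (s : ℕ) → Hist D R O s → ℝ≥0∞) (t : ℕ)
    (h : Hist D R O t) (x : D × (R × O)) :
    cumul F (t + 1) (Fin.snoc h x : Hist D R O (t + 1)) = cumul F t h + F t h := by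
  rw [cumul, Fin.sum_univ_castSucc]
  congr 1
  · refine Finset.sum_congr rfl fun s _ ↦ congrArg (F s) (funext fun i ↦ ?_)
    exact Fin.snoc_castSucc (α := fun _ ↦ D × (R × O)) x h (Fin.castLE s.is_le' i)
  · refine congrArg (F t) (funext fun i ↦ ?_)
    exact Fin.snoc_castSucc (α := fun _ ↦ D × (R × O)) x h i

lemma lintegral_cumul {T : ℕ} (M : Model D R O) (A : Algorithm D R O T)
    (hF : ∀ s, Measurable (F s)) (t : ℕ) :
    ∫⁻ h, cumul F t h ∂(histLaw M A t) =
      ∑ s ∈ Finset.range t, ∫⁻ h, F s h ∂(histLaw M A s) := by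
  induction t with
  | zero => simp [cumul]
  | succ t ih =>
    rw [lintegral_histLaw_succ M A t (measurable_cumul hF (t + 1)), Finset.sum_range_succ, ← ih,
      ← lintegral_add_right _ (hF t)]
    simp [cumul_snoc]

lemma expectedRegret_eq {T : ℕ} (M : Model D R O) (A : Algorithm D R O T) :
    expectedRegret M A =
      ∫⁻ h, cumul (fun s h ↦ ∫⁻ d, gap M d ∂(A.explore s h)) T h ∂(histLaw M A T) := rfl

/-! ### Stopping an algorithm when it has used up a budget -/

/-- The probability that `A` decides in `U` in the next round, given the history. -/
noncomputable def exploreMass {T : ℕ} (A : Algorithm D R O T) (U : Set D) (s : ℕ)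
    (h : Hist D R O s) : ℝ≥0∞ :=
  A.explore s h U

lemma measurable_exploreMass {T : ℕ} (A : Algorithm D R O T) {U : Set D} (hU : MeasurableSet U)
    (s : ℕ) : Measurable (exploreMass A U s) :=
  Kernel.measurable_coe _ hU

lemma measurableSet_budget {T : ℕ} (A : Algorithm D R O T) {U : Set D} (hU : MeasurableSet U)
    (B : ℝ≥0∞) (s : ℕ) :
    MeasurableSet {h : Hist D R O s | cumul (exploreMass A U) s h + exploreMass A U s h ≤ B} :=
  measurableSet_le ((measurable_cumul (measurable_exploreMass A hU) s).add
    (measurable_exploreMass A hU s)) measurable_const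

open Classical in
/-- The algorithm that acts as `A` while the sum of the conditional probabilities of deciding in
`U`, the coming round included, is at most `B`, and decides `d₀` from then on. The probabilities
are known before the decision is drawn, so that the budget is never exceeded. -/
noncomputable def stopped {T : ℕ} (A : Algorithm D R O T) {U : Set D} (hU : MeasurableSet U)
    (B : ℝ≥0∞) (d₀ : D) : Algorithm D R O T where
  explore s := Kernel.piecewise (measurableSet_budget A hU B s) (A.explore s)
    (Kernel.const _ (Measure.dirac d₀))
  isMarkov_explore _ := inferInstance
  output := A.output
  isMarkov_output := A.isMarkov_output

section Stopped

variable {T : ℕ} (A : Algorithm D R O T) {U : Set D} (hU : MeasurableSet U) (B : ℝ≥0∞) (d₀ : D)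

lemma stopped_explore_of_le {s : ℕ} {h : Hist D R O s}
    (hB : cumul (exploreMass A U) s h + exploreMass A U s h ≤ B) :
    (stopped A hU B d₀).explore s h = A.explore s h := by
  rw [stopped, Kernel.piecewise_apply]
  exact if_pos hB

lemma stopped_explore_of_not_le {s : ℕ} {h : Hist D R O s}
    (hB : ¬ cumul (exploreMass A U) s h + exploreMass A U s h ≤ B) :
    (stopped A hU B d₀).explore s h = Measure.dirac d₀ := by
  rw [stopped, Kernel.piecewise_apply]
  exact if_neg hB

lemma exploreMass_stopped_le (hd₀ : d₀ ∉ U) (s : ℕ) (h : Hist D R O s) :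
    exploreMass (stopped A hU B d₀) U s h ≤ exploreMass A U s h := by
  by_cases hB : cumul (exploreMass A U) s h + exploreMass A U s h ≤ B
  · rw [exploreMass, stopped_explore_of_le A hU B d₀ hB, exploreMass]
  · rw [exploreMass, stopped_explore_of_not_le A hU B d₀ hB]
    simp [hU, hd₀]

lemma cumul_stopped_le (hd₀ : d₀ ∉ U) (t : ℕ) (h : Hist D R O t) :
    cumul (exploreMass (stopped A hU B d₀) U) t h ≤ B := by
  induction t with
  | zero => simp [cumul]
  | succ t ih =>
    rw [← Fin.snoc_init_self h, cumul_snoc]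
    set h' : Hist D R O t := Fin.init h
    by_cases hB : cumul (exploreMass A U) t h' + exploreMass A U t h' ≤ B
    · refine le_trans (add_le_add ?_ (exploreMass_stopped_le A hU B d₀ hd₀ t h')) hB
      exact Finset.sum_le_sum fun s _ ↦ exploreMass_stopped_le A hU B d₀ hd₀ s _
    · have h0 : exploreMass (stopped A hU B d₀) U t h' = 0 := by
        rw [exploreMass, stopped_explore_of_not_le A hU B d₀ hB]
        simp [hU, hd₀]
      rw [h0, add_zero]
      exact ih h'

/-- Within the budget, the stopped and the original algorithm have the same law. -/
lemma lintegral_indicator_stopped (M : Model D R O) (t : ℕ) {G : Hist D R O t → ℝ≥0∞}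
    (hG : Measurable G) :
    ∫⁻ h, {h | cumul (exploreMass A U) t h ≤ B}.indicator G h
        ∂(histLaw M (stopped A hU B d₀) t) =
      ∫⁻ h, {h | cumul (exploreMass A U) t h ≤ B}.indicator G h ∂(histLaw M A t) := by
  have hc := measurable_cumul (measurable_exploreMass A hU)
  induction t with
  | zero => rfl
  | succ t ih =>
    have hGi : Measurable ({h | cumul (exploreMass A U) (t + 1) h ≤ B}.indicator G) :=
      hG.indicator (measurableSet_le (hc (t + 1)) measurable_const)
    rw [lintegral_histLaw_succ _ _ _ hGi, lintegral_histLaw_succ _ _ _ hGi]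
    set J : Hist D R O t → ℝ≥0∞ := fun h ↦ ∫⁻ d, ∫⁻ x,
      {h | cumul (exploreMass A U) (t + 1) h ≤ B}.indicator G (Fin.snoc h (d, x))
        ∂(M.law d) ∂(A.explore t h) with hJ
    have hJm : Measurable J := by
      have h1 : Measurable fun q : (Hist D R O t × D) × (R × O) ↦
          {h | cumul (exploreMass A U) (t + 1) h ≤ B}.indicator G
            (Fin.snoc q.1.1 (q.1.2, q.2) : Hist D R O (t + 1)) :=
        hGi.comp ((measurable_snoc t).comp
          (measurable_fst.fst.prodMk (measurable_fst.snd.prodMk measurable_snd)))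
      have h2 := h1.lintegral_kernel_prod_right' (κ := Kernel.prodMkLeft (Hist D R O t) M.law)
      exact h2.lintegral_kernel_prod_right' (κ := A.explore t)
    -- the indicator vanishes unless the budget lasts for the round that follows `h`
    have hout : ∀ h : Hist D R O t,
        ¬ cumul (exploreMass A U) t h + exploreMass A U t h ≤ B → ∀ d x,
        {h | cumul (exploreMass A U) (t + 1) h ≤ B}.indicator G
          (Fin.snoc h (d, x) : Hist D R O (t + 1)) = 0 := by
      intro h hB d x
      refine Set.indicator_of_notMem ?_ _
      rwa [Set.mem_ofPred_eq, cumul_snoc]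
    have hJi : J = {h | cumul (exploreMass A U) t h ≤ B}.indicator J := by
      funext h
      by_cases hB : cumul (exploreMass A U) t h ≤ B
      · exact (Set.indicator_of_mem (s := {h | cumul (exploreMass A U) t h ≤ B}) hB J).symm
      · rw [Set.indicator_of_notMem (s := {h | cumul (exploreMass A U) t h ≤ B}) hB, hJ]
        simp [hout h fun hB' ↦ hB (le_self_add.trans hB')]
    have hJs : ∀ h : Hist D R O t, ∫⁻ d, ∫⁻ x,
        {h | cumul (exploreMass A U) (t + 1) h ≤ B}.indicator G (Fin.snoc h (d, x))
          ∂(M.law d) ∂((stopped A hU B d₀).explore t h) = J h := by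
      intro h
      by_cases hB : cumul (exploreMass A U) t h + exploreMass A U t h ≤ B
      · rw [stopped_explore_of_le A hU B d₀ hB]
      · simp [hJ, hout h hB]
    rw [lintegral_congr hJs]
    change _ = ∫⁻ h, J h ∂(histLaw M A t)
    rw [hJi]
    exact ih hJm

/-- Stopping changes the mean of a `[0, 1]`-valued function by at most the probability that the
original algorithm exceeds the budget. -/
lemma lintegral_stopped_le (M : Model D R O) (t : ℕ) {f : Hist D R O t → ℝ≥0∞}
    (hf : Measurable f) (hf1 : ∀ h, f h ≤ 1) :
    ∫⁻ h, f h ∂(histLaw M (stopped A hU B d₀) t) ≤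
      ∫⁻ h, f h ∂(histLaw M A t) +
        histLaw M A t {h | B < cumul (exploreMass A U) t h} := by
  set S : Set (Hist D R O t) := {h | cumul (exploreMass A U) t h ≤ B} with hS_def
  have hS : MeasurableSet S :=
    measurableSet_le (measurable_cumul (measurable_exploreMass A hU) t) measurable_const
  have hSc : Sᶜ = {h | B < cumul (exploreMass A U) t h} := by ext; simp [S]
  have h1 := lintegral_indicator_stopped A hU B d₀ M t (G := 1) measurable_one
  rw [lintegral_indicator_one hS, lintegral_indicator_one hS] at h1
  have h2 := lintegral_indicator_stopped A hU B d₀ M t hf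
  rw [lintegral_indicator hS, lintegral_indicator hS] at h2
  rw [← lintegral_add_compl f hS, h2, ← hSc]
  refine add_le_add (setLIntegral_le_lintegral _ _) ?_
  calc ∫⁻ h in Sᶜ, f h ∂(histLaw M (stopped A hU B d₀) t)
      ≤ ∫⁻ _ in Sᶜ, 1 ∂(histLaw M (stopped A hU B d₀) t) := lintegral_mono hf1
    _ = histLaw M A t Sᶜ := by
      rw [setLIntegral_one, prob_compl_eq_one_sub hS, prob_compl_eq_one_sub hS, h1]

end Stopped

/-! ### Gaps -/

lemma bddAbove_meanReward (M : Model D R O) : BddAbove (Set.range (meanReward M)) :=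
  ⟨1, by rintro _ ⟨d, rfl⟩; exact (M.mean_mem d).2⟩

lemma measurable_meanReward (M : Model D R O) : Measurable (meanReward M) :=
  (StronglyMeasurable.integral_kernel (κ := M.law)
    (f := fun x : R × O ↦ (x.1 : ℝ)) (by fun_prop)).measurable

lemma measurable_gap (M : Model D R O) : Measurable (gap M) :=
  (measurable_const.sub (measurable_meanReward M)).ennreal_ofReal

lemma gap_le_one (M : Model D R O) (d : D) : gap M d ≤ 1 := by
  rw [gap, ← ENNReal.ofReal_one]
  refine ENNReal.ofReal_le_ofReal ?_
  have : Nonempty D := ⟨d⟩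
  have h1 : ⨆ d', meanReward M d' ≤ 1 := ciSup_le fun d' ↦ (M.mean_mem d').2
  have h2 : 0 ≤ meanReward M d := (M.mean_mem d).1
  linarith

lemma gap_eq_zero_iff (M : Model D R O) (d : D) : gap M d = 0 ↔ d ∈ optSet M := by
  have : Nonempty D := ⟨d⟩
  rw [gap, ENNReal.ofReal_eq_zero, sub_nonpos, ciSup_le_iff (bddAbove_meanReward M)]
  rfl

lemma measurableSet_optSet (M : Model D R O) : MeasurableSet (optSet M) := by
  have h : optSet M = gap M ⁻¹' {0} := by ext d; exact (gap_eq_zero_iff M d).symm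
  rw [h]
  exact measurable_gap M (measurableSet_singleton 0)

lemma minGap_le_gap (M : Model D R O) {d : D} (hd : d ∉ optSet M) : minGap M ≤ gap M d := by
  rw [minGap]
  split_ifs
  · exact iInf_le (fun d : {d : D // 0 < gap M d} ↦ gap M d.1)
      ⟨d, pos_iff_ne_zero.2 fun h ↦ hd ((gap_eq_zero_iff M d).1 h)⟩
  · exact zero_le

lemma lintegral_gap_le_one (M : Model D R O) (μ : Measure D) [IsProbabilityMeasure μ] :
    ∫⁻ d, gap M d ∂μ ≤ 1 :=
  (lintegral_mono (gap_le_one M)).trans (by simp)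

/-! ### The regret bounds the number of suboptimal decisions -/

lemma lintegral_cumul_eq_zero_of_expectedRegret_eq_zero {T : ℕ} (M : Model D R O)
    (A : Algorithm D R O T) {U : Set D} (hU : MeasurableSet U) (hUM : Disjoint U (optSet M))
    (h0 : expectedRegret M A = 0) :
    ∫⁻ h, cumul (exploreMass A U) T h ∂(histLaw M A T) = 0 := by
  have hgk : ∀ s, Measurable fun h : Hist D R O s ↦ ∫⁻ d, gap M d ∂(A.explore s h) :=
    fun s ↦ (measurable_gap M).lintegral_kernel
  rw [expectedRegret_eq, lintegral_cumul M A hgk, Finset.sum_eq_zero_iff] at h0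
  rw [lintegral_cumul M A (measurable_exploreMass A hU), Finset.sum_eq_zero_iff]
  intro s hs
  rw [lintegral_eq_zero_iff (measurable_exploreMass A hU s)]
  filter_upwards [(lintegral_eq_zero_iff (hgk s)).1 (h0 s hs)] with h hh
  have h1 : ∀ᵐ d ∂(A.explore s h), gap M d = 0 := (lintegral_eq_zero_iff (measurable_gap M)).1 hh
  refine measure_mono_null (fun d hd ↦ ?_) (ae_iff.1 h1)
  exact fun hd0 ↦ Set.disjoint_left.1 hUM hd ((gap_eq_zero_iff M d).1 hd0)

lemma minGap_mul_lintegral_cumul_le {T : ℕ} (M : Model D R O)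
    (A : Algorithm D R O T) {U : Set D} (hU : MeasurableSet U) (hUM : Disjoint U (optSet M)) :
    minGap M * ∫⁻ h, cumul (exploreMass A U) T h ∂(histLaw M A T) ≤ expectedRegret M A := by
  rw [← lintegral_const_mul _ (measurable_cumul (measurable_exploreMass A hU) T),
    expectedRegret_eq]
  refine lintegral_mono fun h ↦ ?_
  rw [cumul, Finset.mul_sum]
  refine Finset.sum_le_sum fun s _ ↦ ?_
  calc minGap M * A.explore s _ U = ∫⁻ _ in U, minGap M ∂(A.explore s _) := by
        rw [setLIntegral_const]
    _ ≤ ∫⁻ d in U, gap M d ∂(A.explore s _) :=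
        setLIntegral_mono (measurable_gap M) fun d hd ↦
          minGap_le_gap M (Set.disjoint_left.1 hUM hd)
    _ ≤ _ := setLIntegral_le_lintegral _ _

/-- An algorithm with logarithmic regret decides in a set of suboptimal decisions rarely. The
proof checks the degenerate cases: `l = 0`, where the regret vanishes, and `minGap M = ∞`, where
there is no suboptimal decision. -/
lemma lintegral_cumul_le_of_expectedRegret_le {T : ℕ} (M : Model D R O)
    (A : Algorithm D R O T) {U : Set D} (hU : MeasurableSet U) (hUM : Disjoint U (optSet M))
    {g l L : ℝ≥0∞} (hg : g ≠ 0) (hreg : expectedRegret M A ≤ 2 * g * l)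
    (hL : g / minGap M * l ≤ L) (hLtop : L ≠ ∞) :
    ∫⁻ h, cumul (exploreMass A U) T h ∂(histLaw M A T) ≤ 2 * L := by
  rcases eq_or_ne l 0 with rfl | hl
  · rw [lintegral_cumul_eq_zero_of_expectedRegret_eq_zero M A hU hUM (by simpa using hreg)]
    exact zero_le
  have hgm : g / minGap M ≠ ∞ := fun h ↦ by
    rw [h, ENNReal.top_mul hl] at hL
    exact hLtop (top_le_iff.1 hL)
  have hm0 : minGap M ≠ 0 := fun h ↦ hgm (by rw [h, ENNReal.div_zero hg])
  rcases eq_or_ne (minGap M) ∞ with hmt | hmt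
  · have hUe : U = ∅ := by
      refine Set.eq_empty_of_forall_notMem fun d hd ↦ ?_
      have h1 := (minGap_le_gap M (Set.disjoint_left.1 hUM hd)).trans (gap_le_one M d)
      rw [hmt] at h1
      exact absurd h1 (by simp)
    simp [cumul, exploreMass, hUe]
  · have h1 := (minGap_mul_lintegral_cumul_le M A hU hUM).trans hreg
    rw [mul_comm, ← ENNReal.le_div_iff_mul_le (Or.inl hm0) (Or.inl hmt)] at h1
    refine h1.trans (le_trans (le_of_eq ?_) (mul_le_mul_right hL 2))
    simp only [div_eq_mul_inv]
    ring


/-! ### Averages of near-optimal allocations -/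

lemma measurable_coe_probabilityMeasure :
    Measurable fun lam : ProbabilityMeasure D ↦ (lam : Measure D) :=
  measurable_subtype_coe

lemma measurable_kl [MeasurableSpace.CountableOrCountablyGenerated D (R × O)]
    (M M' : Model D R O) : Measurable (kl M M') :=
  measurable_klDiv_kernel M.law M'.law

/-- Once the tolerance is at least `1`, the information constraint is void, and every allocation
is near-optimal with a small normalization factor. -/
lemma mem_glAlloc_of_one_le (𝓜 : Set (Model D R O)) (M : Model D R O) {ε : ℝ} (hε : 1 ≤ ε)
    (hg : glc 𝓜 M ≠ 0) (lam : ProbabilityMeasure D) : lam ∈ glAlloc 𝓜 M ε := by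
  have hinfo : ∀ n : ℝ, 0 < n → ENNReal.ofReal ((1 - ε) / n) ≤
      ⨅ M' ∈ altSet 𝓜 M, ∫⁻ d, kl M M' d ∂(lam : Measure D) := fun n hn ↦ by
    rw [ENNReal.ofReal_of_nonpos (div_nonpos_of_nonpos_of_nonneg (by linarith) hn.le)]
    exact zero_le
  have h1 : 1 ≤ ENNReal.ofReal (1 + ε) := by
    rw [← ENNReal.ofReal_one]
    exact ENNReal.ofReal_le_ofReal (by linarith)
  rcases eq_or_ne (glc 𝓜 M) ∞ with ht | ht
  · refine ⟨1, one_pos, ?_, hinfo 1 one_pos⟩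
    rw [ht, ENNReal.mul_top (one_pos.trans_le h1).ne']
    simp
  · refine ⟨(glc 𝓜 M).toReal, ENNReal.toReal_pos hg ht, ?_, hinfo _ (ENNReal.toReal_pos hg ht)⟩
    rw [ENNReal.ofReal_toReal ht, ENNReal.mul_div_cancel_right hg ht]
    exact (lintegral_gap_le_one M _).trans h1

/-- The mean of a random allocation that is `ε`-optimal with high probability is
`2 * ε`-optimal. The reciprocal of its normalization factor is the mean, over the good event, of
the least reciprocal that the regret bound allows; unlike an arbitrary admissible factor, this one
depends measurably on the allocation. -/
lemma mem_glAlloc_of_eq_bind [MeasurableSpace.CountableOrCountablyGenerated D (R × O)]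
    (𝓜 : Set (Model D R O)) (M : Model D R O) {ε nmax : ℝ} (hε : 0 < ε) (hn : 0 < nmax)
    (hg : glc 𝓜 M ≠ 0) (ρ : Measure (ProbabilityMeasure D)) [IsProbabilityMeasure ρ]
    {S : Set (ProbabilityMeasure D)} (hS : MeasurableSet S)
    (hbad : (glAllocMax 𝓜 M ε nmax)ᶜ ⊆ S)
    (hρS : ρ S ≤ ENNReal.ofReal (ε / 2) * min 1 (glc 𝓜 M / ENNReal.ofReal nmax))
    {lam : ProbabilityMeasure D}
    (hlam : (lam : Measure D) = ρ.bind fun lam' : ProbabilityMeasure D ↦ (lam' : Measure D)) :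
    lam ∈ glAlloc 𝓜 M (2 * ε) := by
  rcases le_or_gt 1 (2 * ε) with h1 | h1
  · exact mem_glAlloc_of_one_le 𝓜 M h1 hg lam
  have hcoe := measurable_coe_probabilityMeasure (D := D)
  have hmean : ∀ f : D → ℝ≥0∞, Measurable f →
      ∫⁻ d, f d ∂(lam : Measure D) = ∫⁻ lam', ∫⁻ d, f d ∂(lam' : Measure D) ∂ρ := fun f hf ↦ by
    rw [hlam, Measure.lintegral_bind hcoe.aemeasurable hf.aemeasurable]
  set g := glc 𝓜 M with hg_def
  set c : ℝ≥0∞ := ENNReal.ofReal (1 + ε) with hc_def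
  set N : ℝ≥0∞ := ENNReal.ofReal nmax with hN_def
  have hc0 : c ≠ 0 := by simp only [hc_def, ne_eq, ENNReal.ofReal_eq_zero]; linarith
  have hcg : c * g ≠ 0 := mul_ne_zero hc0 hg
  have hN0 : N ≠ 0 := by simpa [hN_def] using hn
  have hNinv : N⁻¹ ≠ 0 := by simp [hN_def]
  -- the least reciprocal normalization factor compatible with the regret bound
  let w : ProbabilityMeasure D → ℝ≥0∞ := fun lam' ↦
    max N⁻¹ ((∫⁻ d, gap M d ∂(lam' : Measure D)) / (c * g))
  have hw_reg : ∀ lam' : ProbabilityMeasure D,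
      ∫⁻ d, gap M d ∂(lam' : Measure D) ≤ c * g * w lam' := fun lam' ↦ by
    have hw0 : w lam' ≠ 0 := ((pos_iff_ne_zero.2 hNinv).trans_le (le_max_left _ _)).ne'
    rw [mul_comm]
    exact (ENNReal.div_le_iff_le_mul (Or.inl hcg) (Or.inr hw0)).1 (le_max_right _ _)
  have hw_info : ∀ lam' ∈ Sᶜ, ∀ M' ∈ altSet 𝓜 M,
      ENNReal.ofReal (1 - ε) * w lam' ≤ ∫⁻ d, kl M M' d ∂(lam' : Measure D) := by
    intro lam' hlam' M' hM'
    obtain ⟨n, hn0, hnn, hreg, hinfo⟩ : lam' ∈ glAllocMax 𝓜 M ε nmax := by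
      by_contra hcon
      exact hlam' (hbad hcon)
    have hw : w lam' ≤ (ENNReal.ofReal n)⁻¹ := by
      refine max_le (ENNReal.inv_le_inv.2 (ENNReal.ofReal_le_ofReal hnn)) ?_
      refine ENNReal.div_le_of_le_mul ?_
      rwa [mul_comm, ← div_eq_mul_inv]
    refine le_trans ?_ (hinfo.trans (iInf₂_le M' hM'))
    rw [ENNReal.ofReal_div_of_pos hn0, div_eq_mul_inv]
    gcongr
  have hw_top : ∀ lam', w lam' ≤ N⁻¹ + 1 / (c * g) := fun lam' ↦
    max_le le_self_add
      ((ENNReal.div_le_div_right (lintegral_gap_le_one M _) _).trans le_add_self)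
  set a : ℝ≥0∞ := ∫⁻ lam' in Sᶜ, w lam' ∂ρ with ha_def
  have ha_top : a ≠ ∞ := by
    refine ne_top_of_le_ne_top ?_
      ((setLIntegral_le_lintegral _ _).trans (lintegral_mono hw_top))
    rw [lintegral_const, measure_univ, mul_one]
    exact ENNReal.add_ne_top.2 ⟨ENNReal.inv_ne_top.2 hN0, ENNReal.div_ne_top ENNReal.one_ne_top hcg⟩
  have hSc : 2⁻¹ ≤ ρ Sᶜ := by
    have hS2 : ρ S ≤ 2⁻¹ := by
      refine hρS.trans ((mul_le_mul_right (min_le_left _ _) _).trans ?_)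
      rw [mul_one, ← ENNReal.ofReal_ofNat, ← ENNReal.ofReal_inv_of_pos two_pos]
      exact ENNReal.ofReal_le_ofReal (by linarith)
    rw [prob_compl_eq_one_sub hS]
    exact (ENNReal.one_sub_inv_two).symm.le.trans (tsub_le_tsub_left hS2 1)
  have ha_low : N⁻¹ * 2⁻¹ ≤ a := by
    calc N⁻¹ * 2⁻¹ ≤ N⁻¹ * ρ Sᶜ := by gcongr
      _ = ∫⁻ _ in Sᶜ, N⁻¹ ∂ρ := (setLIntegral_const _ _).symm
      _ ≤ a := lintegral_mono fun _ ↦ le_max_left _ _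
  have ha0 : a ≠ 0 := fun h ↦ by
    rw [h] at ha_low
    simp [hN_def] at ha_low
  have ha_pos : 0 < a.toReal := ENNReal.toReal_pos ha0 ha_top
  have hρSa : ρ S ≤ ENNReal.ofReal ε * g * a := by
    calc ρ S ≤ ENNReal.ofReal (ε / 2) * (g / N) :=
          hρS.trans (mul_le_mul_right (min_le_right _ _) _)
      _ = ENNReal.ofReal ε * g * (N⁻¹ * 2⁻¹) := by
          rw [ENNReal.ofReal_div_of_pos two_pos, ENNReal.ofReal_ofNat, div_eq_mul_inv,
            div_eq_mul_inv]
          ring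
      _ ≤ _ := by gcongr
  refine ⟨(a.toReal)⁻¹, inv_pos.2 ha_pos, ?_, ?_⟩
  · rw [ENNReal.ofReal_inv_of_pos ha_pos, ENNReal.ofReal_toReal ha_top, div_eq_mul_inv, inv_inv,
      hmean _ (measurable_gap M), ← lintegral_add_compl _ hS]
    have hε2 : ENNReal.ofReal (1 + 2 * ε) = ENNReal.ofReal ε + c := by
      rw [hc_def, ← ENNReal.ofReal_add hε.le (by linarith)]
      congr 1
      ring
    rw [← hg_def, hε2, add_mul, add_mul]
    refine add_le_add (le_trans ?_ hρSa) ?_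
    · calc ∫⁻ lam' in S, ∫⁻ d, gap M d ∂(lam' : Measure D) ∂ρ ≤ ∫⁻ _ in S, 1 ∂ρ :=
            lintegral_mono fun lam' ↦ lintegral_gap_le_one M _
        _ = ρ S := setLIntegral_one _
    · have hw_meas : Measurable w := measurable_const.max
        (((Measure.measurable_lintegral (measurable_gap M)).comp hcoe).div_const _)
      rw [ha_def, ← lintegral_const_mul _ hw_meas]
      exact lintegral_mono hw_reg
  · refine le_iInf₂ fun M' hM' ↦ ?_
    rw [hmean _ (measurable_kl M M'), div_inv_eq_mul]
    calc ENNReal.ofReal ((1 - 2 * ε) * a.toReal)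
        ≤ ENNReal.ofReal ((1 - ε) * a.toReal) :=
          ENNReal.ofReal_le_ofReal (mul_le_mul_of_nonneg_right (by linarith) ha_pos.le)
      _ = ENNReal.ofReal (1 - ε) * a := by
          rw [ENNReal.ofReal_mul (by linarith), ENNReal.ofReal_toReal ha_top]
      _ = ∫⁻ lam' in Sᶜ, ENNReal.ofReal (1 - ε) * w lam' ∂ρ :=
          (lintegral_const_mul' _ _ ENNReal.ofReal_ne_top).symm
      _ ≤ ∫⁻ lam' in Sᶜ, ∫⁻ d, kl M M' d ∂(lam' : Measure D) ∂ρ :=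
          setLIntegral_mono' hS.compl fun lam' hlam' ↦ hw_info lam' hlam' M' hM'
      _ ≤ _ := setLIntegral_le_lintegral _ _

/-! ### The lower bound -/

lemma delta_le (𝓜 : Set (Model D R O)) {𝓜₀ : Set (Model D R O)} (ε nmax : ℝ) {M : Model D R O}
    (hM : M ∈ 𝓜₀) :
    delta 𝓜 𝓜₀ ε nmax ≤ ENNReal.ofReal (ε / 2) * min 1 (glc 𝓜 M / ENNReal.ofReal nmax) :=
  mul_le_mul_right (min_le_min_left _ (iInf₂_le M hM)) _

lemma delta_ne_top (𝓜 𝓜₀ : Set (Model D R O)) (ε nmax : ℝ) : delta 𝓜 𝓜₀ ε nmax ≠ ∞ :=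
  ENNReal.mul_ne_top ENNReal.ofReal_ne_top (ne_top_of_le_ne_top ENNReal.one_ne_top (min_le_left _ _))

lemma exists_mem_lt_inv_of_lt_aec {𝓜 𝓝 : Set (Model D R O)} {ε : ℝ} {Mbar : Model D R O}
    {X : ℝ≥0∞} (hX : X < aec 𝓜 ε 𝓝 Mbar) (lam ω : ProbabilityMeasure D) :
    ∃ M ∈ 𝓝 \ glModels 𝓜 ε lam, X < (∫⁻ d, kl Mbar M d ∂(ω : Measure D))⁻¹ := by
  have h := hX.trans_le (iInf₂_le lam ω)
  simpa only [lt_iSup_iff, exists_prop] using h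

/-- For an algorithm that surely stays within the budget `B` for decisions in `U`, the divergence
between the laws of the histories is at most `B` times a mean divergence between the models, under
an allocation that does not depend on the second model: decisions outside `U` are not
informative. -/
lemma exists_klDiv_histLaw_le_mul [MeasurableSpace.CountableOrCountablyGenerated D (R × O)]
    {T : ℕ} (Mbar : Model D R O) (A : Algorithm D R O T) (μ₀ : ProbabilityMeasure D)
    {U : Set D} (hU : MeasurableSet U) {B : ℝ≥0∞} (hB : B ≠ ∞)
    (hA : ∀ h, cumul (exploreMass A U) T h ≤ B) :
    ∃ ω : ProbabilityMeasure D, ∀ M : Model D R O, (∀ d ∉ U, kl Mbar M d = 0) →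
      klDiv (histLaw Mbar A T) (histLaw M A T) ≤ B * ∫⁻ d, kl Mbar M d ∂(ω : Measure D) := by
  set ν : Measure D := ∑ s ∈ Finset.range T,
    ((histLaw Mbar A s).bind (A.explore s)).restrict U with hν
  have hνB : ν Set.univ ≤ B := by
    have h1 : ν Set.univ = ∫⁻ h, cumul (exploreMass A U) T h ∂(histLaw Mbar A T) := by
      rw [lintegral_cumul Mbar A (measurable_exploreMass A hU), hν, Measure.finsetSum_apply]
      refine Finset.sum_congr rfl fun s _ ↦ ?_
      rw [Measure.restrict_apply_univ, Measure.bind_apply hU (A.explore s).aemeasurable]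
      rfl
    rw [h1]
    exact (lintegral_mono hA).trans (by simp)
  have : IsFiniteMeasure ν := ⟨hνB.trans_lt hB.lt_top⟩
  obtain ⟨ω, hω⟩ := exists_probabilityMeasure_lintegral_eq μ₀ ν
  refine ⟨ω, fun M hM ↦ ?_⟩
  refine (klDiv_histLaw_le Mbar M A T).trans ?_
  refine le_trans (le_of_eq ?_) (mul_le_mul_left hνB _)
  rw [← hω, hν, lintegral_finsetSum_measure]
  refine Finset.sum_congr rfl fun s _ ↦ ?_
  have hkl := measurable_kl Mbar M
  rw [← Measure.lintegral_bind (A.explore s).aemeasurable hkl.aemeasurable,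
    ← lintegral_add_compl _ hU, setLIntegral_congr_fun hU.compl (fun d hd ↦ hM d hd)]
  simp

/-- A model without an optimal decision has minimum gap `0`, which forces `l = 0` and so zero
regret; but then some decision has gap zero, that is, it is optimal. -/
lemma optSet_nonempty_of_logarithmic_regret {T : ℕ} (hT : 1 ≤ T) (M : Model D R O)
    (A : Algorithm D R O T) {g l L : ℝ≥0∞} (hg : g ≠ 0) (hreg : expectedRegret M A ≤ 2 * g * l)
    (hL : g / minGap M * l ≤ L) (hLtop : L ≠ ∞) : (optSet M).Nonempty := by
  by_contra hne
  rw [Set.not_nonempty_iff_eq_empty] at hne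
  have hm : minGap M = 0 := by
    rw [minGap, if_neg]
    rintro ⟨d, hd, -⟩
    simp [hne] at hd
  have hl : l = 0 := by
    by_contra hl
    rw [hm, ENNReal.div_zero hg, ENNReal.top_mul hl] at hL
    exact hLtop (top_le_iff.1 hL)
  have h0 := lintegral_cumul_eq_zero_of_expectedRegret_eq_zero M A MeasurableSet.univ
    (by simp [hne]) (by simpa [hl] using hreg)
  have h1 : ∀ h : Hist D R O T, cumul (exploreMass A Set.univ) T h = T := fun h ↦ by
    simp [cumul, exploreMass]
  simp only [h1, lintegral_const, measure_univ, mul_one, Nat.cast_eq_zero] at h0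
  omega

lemma outputLaw_apply {T : ℕ} (M : Model D R O) (A : Algorithm D R O T)
    {S : Set (ProbabilityMeasure D)} (hS : MeasurableSet S) :
    outputLaw M A S = ∫⁻ h, A.output h S ∂(histLaw M A T) :=
  Measure.bind_apply hS A.output.aemeasurable

instance isProbabilityMeasure_outputLaw {T : ℕ} (M : Model D R O) (A : Algorithm D R O T) :
    IsProbabilityMeasure (outputLaw M A) :=
  ⟨by simp [outputLaw_apply M A MeasurableSet.univ]⟩

/-- If `A` exceeds the budget rarely under `M`, and the budget is too small for the stopped
algorithm to tell `M` from `Mbar`, then an event that is rare for the output under `M` is rare for the output of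
the stopped algorithm under `Mbar`. -/
lemma outputLaw_stopped_le {T : ℕ} (M Mbar : Model D R O) (A : Algorithm D R O T)
    {U : Set D} (hU : MeasurableSet U) (B : ℝ≥0∞) (d₀ : D)
    {S : Set (ProbabilityMeasure D)} (hS : MeasurableSet S) :
    outputLaw Mbar (stopped A hU B d₀) S / 2 ≤
      klDiv (histLaw Mbar (stopped A hU B d₀) T) (histLaw M (stopped A hU B d₀) T) +
        (outputLaw M A S + histLaw M A T {h | B < cumul (exploreMass A U) T h}) := by
  rw [outputLaw_apply _ _ hS, outputLaw_apply _ _ hS]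
  have hf : Measurable fun h ↦ A.output h S := Kernel.measurable_coe _ hS
  have hf1 : ∀ h, A.output h S ≤ 1 := fun h ↦ prob_le_one
  refine (lintegral_div_two_le_klDiv_add _ (histLaw M (stopped A hU B d₀) T) hf hf1).trans ?_
  exact add_le_add le_rfl (lintegral_stopped_le A hU B d₀ M T hf hf1)

end DMSO

open DMSO in
theorem theorem3p2 :
    ∃ c : ℝ, 0 < c ∧
      ∀ (D : Type*) [MeasurableSpace D] (R : Set ℝ) (O : Type*) [MeasurableSpace O]
        [MeasurableSpace.CountableOrCountablyGenerated D (R × O)]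
        (𝓜 𝓜₀ : Set (DMSO.Model D R O)) (_ : 𝓜₀ ⊆ 𝓜)
        (ε nmax : ℝ) (_ : 0 < ε) (_ : 0 < nmax) (T : ℕ) (_ : 1 ≤ T)
        (_ : (⨆ M ∈ 𝓜₀, DMSO.glc 𝓜 M / DMSO.minGap M) * ENNReal.ofReal (Real.log T) <
          ENNReal.ofReal c * DMSO.delta 𝓜 𝓜₀ ε nmax ^ 2 *
            ⨆ Mbar : DMSO.Model D R O, DMSO.aec 𝓜 (2 * ε) (DMSO.optModels 𝓜₀ Mbar) Mbar),
        ¬ ∃ A : DMSO.Algorithm D R O T,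
          (∀ M ∈ 𝓜₀, DMSO.expectedRegret M A ≤
            2 * DMSO.glc 𝓜 M * ENNReal.ofReal (Real.log T)) ∧
          (∀ M ∈ 𝓜₀, DMSO.outputLaw M A (DMSO.glAllocMax 𝓜 M ε nmax)ᶜ ≤
            DMSO.delta 𝓜 𝓜₀ ε nmax / 12) := by
  refine ⟨1 / 72, by norm_num, ?_⟩
  intro D _ R O _ _ 𝓜 𝓜₀ hsub ε nmax hε hn T hT hlt
  rintro ⟨A, hreg, hout⟩
  set δ := delta 𝓜 𝓜₀ ε nmax with hδ
  set L := (⨆ M ∈ 𝓜₀, glc 𝓜 M / minGap M) * ENNReal.ofReal (Real.log T)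
  have hδt : δ ≠ ∞ := delta_ne_top 𝓜 𝓜₀ ε nmax
  have hLt : L ≠ ∞ := hlt.ne_top
  have hδ0 : δ ≠ 0 := fun h ↦ by simp [h] at hlt
  have hLM : ∀ M ∈ 𝓜₀, glc 𝓜 M / minGap M * ENNReal.ofReal (Real.log T) ≤ L := fun M hM ↦
    mul_le_mul_left (le_iSup₂ (f := fun M (_ : M ∈ 𝓜₀) ↦ glc 𝓜 M / minGap M) M hM) _
  have hg : ∀ M ∈ 𝓜₀, glc 𝓜 M ≠ 0 := fun M hM h ↦ by
    have := delta_le 𝓜 ε nmax hM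
    rw [h, ← hδ] at this
    simp [hδ0] at this
  -- a reference model, and a finite level `X` below its coefficient
  obtain ⟨Mbar, X, hXaec, hLX⟩ : ∃ (Mbar : Model D R O) (X : ℝ≥0∞),
      X < aec 𝓜 (2 * ε) (optModels 𝓜₀ Mbar) Mbar ∧
        L < ENNReal.ofReal (1 / 72) * δ ^ 2 * X := by
    rw [ENNReal.mul_iSup, lt_iSup_iff] at hlt
    obtain ⟨Mbar, hlt⟩ := hlt
    refine ⟨Mbar, ?_⟩
    by_contra! hcon
    refine hlt.not_ge (ENNReal.mul_le_of_forall_lt fun a ha X hX ↦ ?_)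
    exact (mul_le_mul_left ha.le X).trans (hcon X hX)
  have hXt : X ≠ ∞ := hXaec.ne_top
  have hX0 : X ≠ 0 := fun h ↦ by simp [h] at hLX
  have hpick := fun lam ω ↦ exists_mem_lt_inv_of_lt_aec hXaec lam ω
  let μ₀ : ProbabilityMeasure D := ⟨A.explore 0 fun i ↦ i.elim0, inferInstance⟩
  obtain ⟨d₀, hd₀⟩ : (optSet Mbar).Nonempty := by
    obtain ⟨M, ⟨⟨hM, hopt, -⟩, -⟩, -⟩ := hpick μ₀ μ₀
    exact (optSet_nonempty_of_logarithmic_regret hT M A (hg M hM) (hreg M hM) (hLM M hM)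
      hLt).mono hopt
  have hU : MeasurableSet (optSet Mbar)ᶜ := (measurableSet_optSet Mbar).compl
  have hd₀U : d₀ ∉ (optSet Mbar)ᶜ := fun h ↦ h hd₀
  -- the budget makes the divergence of the stopped histories at most `δ / 3`, and is large enough
  -- to be exceeded with probability at most `δ / 12` only
  set B : ℝ≥0∞ := δ * X / 3 with hB
  have hBt : B ≠ ∞ := ENNReal.div_ne_top (ENNReal.mul_ne_top hδt hXt) (by norm_num)
  have hB0 : B ≠ 0 := ENNReal.div_ne_zero.2 ⟨mul_ne_zero hδ0 hX0, by norm_num⟩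
  set A' := stopped A hU B d₀
  obtain ⟨ω, hω⟩ := exists_klDiv_histLaw_le_mul Mbar A' μ₀ hU hBt
    (cumul_stopped_le A hU B d₀ hd₀U T)
  have hbind : IsProbabilityMeasure ((outputLaw Mbar A').bind
      fun lam' : ProbabilityMeasure D ↦ (lam' : Measure D)) := by
    refine ⟨?_⟩
    rw [Measure.bind_apply MeasurableSet.univ measurable_coe_probabilityMeasure.aemeasurable]
    simp
  obtain ⟨M, ⟨⟨hM, hopt, hkl⟩, hMgl⟩, hMX⟩ := hpick ⟨_, hbind⟩ ω
  refine hMgl ⟨hsub hM, ?_⟩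
  have hdisj : Disjoint (optSet Mbar)ᶜ (optSet M) :=
    Set.disjoint_compl_left_iff_subset.2 hopt
  have hKL : klDiv (histLaw Mbar A' T) (histLaw M A' T) ≤ δ / 3 := by
    refine (hω M fun d hd ↦ hkl d (not_not.1 hd)).trans ?_
    calc B * ∫⁻ d, kl Mbar M d ∂(ω : Measure D) ≤ B * X⁻¹ := by
          gcongr
          exact (ENNReal.lt_inv_iff_lt_inv.1 hMX).le
      _ = δ / 3 * (X * X⁻¹) := by rw [hB, div_eq_mul_inv, div_eq_mul_inv]; ring
      _ = δ / 3 := by rw [ENNReal.mul_inv_cancel hX0 hXt, mul_one]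
  have hexc : histLaw M A T {h | B < cumul (exploreMass A (optSet Mbar)ᶜ) T h} ≤ δ / 12 := by
    rw [← ENNReal.mul_le_mul_iff_right hB0 hBt]
    calc B * histLaw M A T {h | B < cumul (exploreMass A (optSet Mbar)ᶜ) T h}
        ≤ B * histLaw M A T {h | B ≤ cumul (exploreMass A (optSet Mbar)ᶜ) T h} := by
          gcongr
          exact le_of_lt
      _ ≤ ∫⁻ h, cumul (exploreMass A (optSet Mbar)ᶜ) T h ∂(histLaw M A T) :=
          mul_meas_ge_le_lintegral (measurable_cumul (measurable_exploreMass A hU) T) B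
      _ ≤ 2 * L := lintegral_cumul_le_of_expectedRegret_le M A hU hdisj (hg M hM) (hreg M hM)
          (hLM M hM) hLt
      _ ≤ 2 * (ENNReal.ofReal (1 / 72) * δ ^ 2 * X) := by gcongr
      _ = B * (δ / 12) := by
          have h1 : 2 * ENNReal.ofReal (1 / 72) = 3⁻¹ * 12⁻¹ := by
            refine (ENNReal.toReal_eq_toReal_iff' (by finiteness) (by finiteness)).1 ?_
            norm_num [ENNReal.toReal_mul, ENNReal.toReal_inv]
          calc 2 * (ENNReal.ofReal (1 / 72) * δ ^ 2 * X)
              = 2 * ENNReal.ofReal (1 / 72) * (δ ^ 2 * X) := by ring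
            _ = B * (δ / 12) := by rw [h1, hB, div_eq_mul_inv, div_eq_mul_inv]; ring
  set S := toMeasurable (outputLaw M A) (glAllocMax 𝓜 M ε nmax)ᶜ
  have hSm : MeasurableSet S := measurableSet_toMeasurable _ _
  have hrare : outputLaw Mbar A' S ≤ δ := by
    have h1 := (outputLaw_stopped_le M Mbar A hU B d₀ hSm).trans
      (add_le_add hKL (add_le_add ((measure_toMeasurable _).le.trans (hout M hM)) hexc))
    have h2 : δ / 3 + (δ / 12 + δ / 12) = δ / 2 := by
      have h3 : (3 : ℝ≥0∞)⁻¹ + (12⁻¹ + 12⁻¹) = 2⁻¹ := by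
        refine (ENNReal.toReal_eq_toReal_iff' (by finiteness) (by finiteness)).1 ?_
        rw [ENNReal.toReal_add (by finiteness) (by finiteness),
          ENNReal.toReal_add (by finiteness) (by finiteness)]
        norm_num [ENNReal.toReal_inv]
      rw [div_eq_mul_inv, div_eq_mul_inv, div_eq_mul_inv, ← h3]
      ring
    rw [h2] at h1
    exact (ENNReal.div_le_iff_le_mul (Or.inl two_ne_zero) (Or.inl (by simp))).1 h1 |>.trans
      (ENNReal.div_mul_cancel two_ne_zero (by simp)).le
  exact mem_glAlloc_of_eq_bind 𝓜 M hε hn (hg M hM) (outputLaw Mbar A') hSm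
    (subset_toMeasurable _ _) (hrare.trans (delta_le 𝓜 ε nmax hM)) rfl
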